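/- Terminology. A game is given by a directed graph $(V,E)$, $E\subseteq V\times V$, in which every vertex has an outgoing edge, a partition $V=V_E\uplus V_A$ of the vertices between two players Eve and Adam, an initial vertex $v_0$, and a colouring $\gamma:E\to\Gamma\cup\{\varepsilon\}$ such that no cycle is coloured exclusively with the neutral letter $\varepsilon$; it is $\varepsilon$-free if $\gamma(e)\neq\varepsilon$ for all $e\in E$. A play is an infinite path from $v_0$, the owner of the current vertex choosing the next edge; its output is the word over $\Gamma$ obtained from its sequence of colours by erasing the occurrences of $\varepsilon$. In an $\mathcal F$-game, for a Muller condition $\mathcal F\subseteq\mathcal P(\Gamma)$, Eve wins a play if and only if its output is infinite and the set of colours occurring infinitely often in the output belongs to $\mathcal F$. Eve wins the game if she has a strategy (a function of the finite history of the play) all of whose plays are won by her. A memory structure is a finite set of states $M$ with an initial state $m_0$ and an update function $\mu:M\times E\to M$; its size is $|M|$. Eve wins with it if there is a function $\mathrm{nextmove}:V_E\times M\to E$, sending $(v,m)$ to an outgoing edge of $v$, such that always playing $\mathrm{nextmove}(v,m)$ (where $v$ is the current vertex and $m$ the current state of the memory, updated by $\mu$ after each edge of the play) is a winning strategy. The memory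 structure is chromatic if there is $\mu':M\times\Gamma\to M$ such that $\mu(m,e)=\mu'(m,\gamma(e))$ whenever $\gamma(e)\ne\varepsilon$, and $\mu(m,e)=m$ whenever $\gamma(e)=\varepsilon$. Proposition. Let $n\ge 2$, let $\Gamma_n$ be a set of $n$ colours, and let $\mathcal F_n=\{A\subseteq\Gamma_n : |A|=2\}$. Then: 1. every $\mathcal F_n$-game that is won by Eve (on a graph of any cardinality) can be won by her with a memory structure of size $2$; 2. there is an $\varepsilon$-free $\mathcal F_n$-game $\mathcal G$ on a finite graph, won by Eve, such that the least size of a chromatic memory structure with which she can win $\mathcal G$ is exactly $n$, while she can win $\mathcal G$ with a general memory structure of size $2$. In particular, for $n\geq 3$, chromatic memory structures are not optimal in $\mathcal G$, which disproves Kopczyński's conjecture that minimal memory structures can always be chosen chromatic. -/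

import Mathlib

/-! Infinite-duration games on directed graphs with coloured edges, and the memory
needed by the existential player (Eve) to win them. -/

namespace ColouredGame

/-- The source of an edge of a directed graph with edge set `E ⊆ V × V`. -/
def src {V : Type*} {E : Set (V × V)} (e : E) : V := e.1.1

/-- The target of an edge. -/
def tgt {V : Type*} {E : Set (V × V)} (e : E) : V := e.1.2

/-- `IsPath v l`: the finite sequence of edges `l` is a path starting in `v`. -/
def IsPath {V : Type*} {E : Set (V × V)} : V → List E → Prop
  | _, [] => True
  | v, e :: l => src e = v ∧ IsPath (tgt e) l

/-- The vertex in which a path `l` starting in `v` ends. -/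
def endOf {V : Type*} {E : Set (V × V)} : V → List E → V
  | v, [] => v
  | _, e :: l => endOf (tgt e) l

/-- `Inf(w)`: the set of letters that appear infinitely often in the infinite word `w`. -/
def infSet {Γ : Type*} (w : ℕ → Γ) : Set Γ := {c | ∃ᶠ k in Filter.atTop, w k = c}

/-- The set of infinite words accepted by the Muller condition `F ⊆ P(Γ)`. -/
def mullerLanguage {Γ : Type*} (F : Set (Set Γ)) : Set (ℕ → Γ) := {w | infSet w ∈ F}

/-- The Muller condition consisting of the sets of exactly two colours,
among `n` colours. -/
def pairCondition (n : ℕ) : Set (Set (Fin n)) := {A | A.ncard = 2}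

end ColouredGame

open ColouredGame in
/-- A game without its winning condition: a directed graph (of any cardinality) on the vertex
set `V`, whose vertices are split between Eve (`eve`) and Adam (the complement of `eve`), with
an initial vertex and a colouring of the edges by `Γ ∪ {ε}`, where `none` stands for `ε`. Every
vertex has an outgoing edge, and no cycle is labelled exclusively with `ε`. -/
structure ColouredGame (V Γ : Type*) where
  eve : Set V
  E : Set (V × V)
  init : V
  colour : E → Option Γ
  exists_edge : ∀ v : V, ∃ e : E, src e = v
  no_eps_cycle : ∀ (v : V) (l : List E), l ≠ [] → IsPath v l → endOf v l = v →
    ∃ e ∈ l, colour e ≠ none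

namespace ColouredGame

variable {V Γ : Type*}

/-- No edge is coloured by `ε`. -/
def EpsFree (G : ColouredGame V Γ) : Prop := ∀ e : G.E, G.colour e ≠ none

/-- A play: an infinite path starting in the initial vertex. -/
def IsPlay (G : ColouredGame V Γ) (ρ : ℕ → G.E) : Prop :=
  src (ρ 0) = G.init ∧ ∀ i, src (ρ (i + 1)) = tgt (ρ i)

/-- The infinite word `w` is the output of `ρ`: it is what remains of the sequence of colours of
`ρ` after erasing all occurrences of `ε`. The function `φ` enumerates in increasing order the
positions whose colour is not `ε`. (If only finitely many positions have a colour other than `ε`,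
which cannot happen in a finite game, there is no such `w`.) -/
def IsOutput (G : ColouredGame V Γ) (ρ : ℕ → G.E) (w : ℕ → Γ) : Prop :=
  ∃ φ : ℕ → ℕ, StrictMono φ ∧ Set.range φ = {i | G.colour (ρ i) ≠ none} ∧
    ∀ k, G.colour (ρ (φ k)) = some (w k)

/-- The play `ρ` is winning for Eve for the winning condition `W ⊆ Γ^ω`. -/
def PlayWon (G : ColouredGame V Γ) (W : Set (ℕ → Γ)) (ρ : ℕ → G.E) : Prop :=
  ∃ w, G.IsOutput ρ w ∧ w ∈ W

/-- `σ` is a strategy for Eve: it assigns to each partial play ending in one of Eve's vertices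
an edge going out of this vertex. (The values of `σ` elsewhere are never used.) -/
def IsStrategy (G : ColouredGame V Γ) (σ : List G.E → G.E) : Prop :=
  ∀ h : List G.E, IsPath G.init h → endOf G.init h ∈ G.eve → src (σ h) = endOf G.init h

/-- The prefix of length `k` of an infinite sequence of edges. -/
def pre {E : Type*} (ρ : ℕ → E) (k : ℕ) : List E := (List.range k).map ρ

/-- The play `ρ` adheres to the strategy `σ`: after each prefix ending in one of Eve's vertices,
the next edge is the one given by `σ`. -/
def Adheres (G : ColouredGame V Γ) (σ : List G.E → G.E) (ρ : ℕ → G.E) : Prop :=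
  ∀ k, endOf G.init (pre ρ k) ∈ G.eve → ρ k = σ (pre ρ k)

/-- `σ` is a winning strategy for Eve. -/
def IsWinningStrategy (G : ColouredGame V Γ) (W : Set (ℕ → Γ)) (σ : List G.E → G.E) : Prop :=
  G.IsStrategy σ ∧ ∀ ρ, G.IsPlay ρ → G.Adheres σ ρ → G.PlayWon W ρ

/-- Eve wins the game `G` with winning condition `W`. -/
def EveWins (G : ColouredGame V Γ) (W : Set (ℕ → Γ)) : Prop :=
  ∃ σ, G.IsWinningStrategy W σ

/-- A memory structure for `G` with set of states `M`. -/
structure Memory (G : ColouredGame V Γ) (M : Type*) where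
  init : M
  update : M → G.E → M

/-- The update function only depends on the colours of the edges, and ignores edges
coloured by `ε`. -/
def Memory.IsChromatic {G : ColouredGame V Γ} {M : Type*} (m : G.Memory M) : Prop :=
  ∃ μ : M → Γ → M, ∀ (q : M) (e : G.E),
    (∀ c, G.colour e = some c → m.update q e = μ q c) ∧
    (G.colour e = none → m.update q e = q)

/-- The strategy given by a memory structure and a next-move function: after the partial play
`h`, play the edge assigned to the current vertex and to the current state of the memory. -/
def Memory.strategy {G : ColouredGame V Γ} {M : Type*} (m : G.Memory M)
    (nextMove : V → M → G.E) : List G.E → G.E :=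
  fun h => nextMove (endOf G.init h) (h.foldl m.update m.init)

/-- The memory structure sets a winning strategy: some next-move function, assigning to each of
Eve's vertices and each memory state an edge going out of the vertex, defines a winning
strategy. (The values of `nextMove` at Adam's vertices are never used.) -/
def Memory.SetsWinningStrategy {G : ColouredGame V Γ} {M : Type*} (m : G.Memory M)
    (W : Set (ℕ → Γ)) : Prop :=
  ∃ nextMove : V → M → G.E, (∀ v ∈ G.eve, ∀ q, src (nextMove v q) = v) ∧
    G.IsWinningStrategy W (m.strategy nextMove)

/-- Eve can win using a memory structure of size `k` (that is, with `k` states). -/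
def EveWinsWithMemory (G : ColouredGame V Γ) (W : Set (ℕ → Γ)) (k : ℕ) : Prop :=
  ∃ m : G.Memory (Fin k), m.SetsWinningStrategy W

/-- Eve can win using a chromatic memory structure of size `k`. -/
def EveWinsWithChromaticMemory (G : ColouredGame V Γ) (W : Set (ℕ → Γ)) (k : ℕ) : Prop :=
  ∃ m : G.Memory (Fin k), m.IsChromatic ∧ m.SetsWinningStrategy W

end ColouredGame

/-! Muller games whose winning sets are the sets of exactly two colours: memory of size two
suffices, but chromatic memory may need one state per colour.

**Upper bound.** Let `trap p Y` be the set of vertices from which Eve can force that either `Y` is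
visited, or both colours of the pair `p` occur infinitely often and no other colour occurs. It is
a greatest fixed point over two attractors, one for each colour of `p`. The least fixed point
`region` of the operator `Y ↦ ⋃ p, trap p Y` is Eve's winning region.

On it two memory states suffice (`eveWinsWithMemory_two_of_mem_region`). A vertex of the region has
a level, which consists of its ordinal stage in the iteration and of the least pair `p` whose trap
contains it at this stage. Levels never increase along the play, so they are eventually constant;
from then on Eve stays in one trap, and the memory state says which of the two colours she attracts
the play to. The ranks of both attractors depend on the level only.

Conversely, a winning strategy `σ` can only exist in the region (`init_mem_region_of_eveWins`), and
determinacy is not needed to see this. If a history consistent with `σ` ends outside the region,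
then for each pair `p` it has a consistent extension that sees a colour outside `p` and again ends
outside the region: otherwise the ends of all its extensions outside the region form a post-fixed
point for `trap p`, because a play that avoids an attractor for ever would avoid a colour of `p` and
be lost (`mem_trap_of_consistent`). Treating every pair again and again yields a play consistent
with `σ` on which no pair is the set of colours occurring infinitely often.

**Lower bound.** In `petalGame`, Adam fixes two colours `i ≠ j` and lets one of them be read `n !`
times; from then on Eve repeatedly chooses which of the two colours is read `n !` times. Remembering
the last colour is a chromatic memory of size `n` with which she wins by alternating. Reading
`n !` times the same colour acts idempotently on a chromatic memory with fewer than `n` states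
(`iterate_factorial_idem`), and by the pigeonhole principle two colours `i` and `j` lead from the
initial state to the same state `q`. Reading either colour then preserves `q`, so that Eve's choice
is always the same, and Adam can open with the same colour. The play has a single colour, and she
loses.
-/

universe u

/-! ### Ranks for least fixed points -/

/-- Elements of a least fixed point have an ordinal rank, the stage of the iteration at which they
appear: an element of rank `a` belongs to the image of the set of elements of rank less than `a`,
and `a` is the least ordinal with this property. -/
theorem exists_rank_of_lfp {V : Type u} (f : Set V →o Set V) :
    ∃ r : V → Ordinal.{u}, (∀ v ∈ f.lfp, v ∈ f {u | u ∈ f.lfp ∧ r u < r v}) ∧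
      ∀ v a, v ∈ f {u | u ∈ f.lfp ∧ r u < a} → r v ≤ a := by
  let A : Ordinal.{u} → Set V := OrdinalApprox.lfpApprox f ⊥
  let r : V → Ordinal.{u} := fun v => sInf {a | v ∈ f (A a)}
  have hA : ∀ v a, v ∈ A a ↔ ∃ b < a, v ∈ f (A b) := by
    intro v a
    simp only [A]
    rw [OrdinalApprox.lfpApprox]
    simp
  have hlfp : ∀ a, A a ⊆ f.lfp := fun a =>
    OrdinalApprox.lfpApprox_le_of_mem_fixedPoints f f.map_lfp bot_le a
  have hr : ∀ v ∈ f.lfp, v ∈ f (A (r v)) := by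
    intro v hv
    obtain ⟨a, ha⟩ := OrdinalApprox.lfp_mem_range_lfpApprox f
    obtain ⟨b, _, hb⟩ := (hA v a).1 (show v ∈ OrdinalApprox.lfpApprox f ⊥ a from ha ▸ hv)
    exact csInf_mem (s := {a | v ∈ f (A a)}) ⟨b, hb⟩
  have h1 : ∀ a, A a ⊆ {u | u ∈ f.lfp ∧ r u < a} := fun a u hu => by
    obtain ⟨b, hb, hub⟩ := (hA u a).1 hu
    exact ⟨hlfp a hu, lt_of_le_of_lt (csInf_le' (s := {a | u ∈ f (A a)}) hub) hb⟩
  have h2 : ∀ a, {u | u ∈ f.lfp ∧ r u < a} ⊆ A a := fun a u hu =>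
    (hA u a).2 ⟨_, hu.2, hr u hu.1⟩
  exact ⟨r, fun v hv => f.mono (h1 _) (hr v hv),
    fun v a hv => csInf_le' (s := {a | v ∈ f (A a)}) (f.mono (h2 a) hv)⟩

theorem eventually_const_of_antitone {α : Type*} [LinearOrder α] [WellFoundedLT α]
    (f : ℕ → α) (hf : ∀ k, f (k + 1) ≤ f k) : ∃ K, ∀ k ≥ K, f k = f K := by
  have hanti : Antitone f := antitone_nat_of_succ_le hf
  obtain ⟨K, hK⟩ : ∃ K, ∀ k, f K ≤ f k := by
    have hw : (Set.range f).Nonempty := ⟨f 0, 0, rfl⟩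
    obtain ⟨K, hK⟩ := (wellFounded_lt (α := α)).min_mem (Set.range f) hw
    exact ⟨K, fun k => by
      rw [hK]; exact not_lt.1 ((wellFounded_lt (α := α)).not_lt_min (Set.range f) ⟨k, rfl⟩)⟩
  exact ⟨K, fun k hk => le_antisymm (hanti hk) (hK k)⟩

namespace ColouredGame

variable {V : Type u} {Γ : Type*}

/-! ### Plays and their outputs -/

/-- The condition that exactly two colours occur infinitely often. -/
def pairLanguage (Γ : Type*) : Set (ℕ → Γ) := mullerLanguage {A : Set Γ | A.ncard = 2}

theorem infSet_of_isOutput {G : ColouredGame V Γ} {ρ : ℕ → G.E} {w : ℕ → Γ}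
    (h : G.IsOutput ρ w) :
    infSet w = {c | ∃ᶠ k in Filter.atTop, G.colour (ρ k) = some c} := by
  obtain ⟨φ, hφ, hr, hw⟩ := h
  ext c
  simp only [infSet, Set.mem_ofPred_eq, Filter.frequently_atTop]
  constructor
  · intro H a
    obtain ⟨k, hk, rfl⟩ := H a
    exact ⟨φ k, hk.trans (hφ.id_le k), hw k⟩
  · intro H a
    obtain ⟨i, hi, hc⟩ := H (φ a)
    have : i ∈ Set.range φ := by rw [hr]; simp [hc]
    obtain ⟨k, rfl⟩ := this
    refine ⟨k, hφ.le_iff_le.1 hi, ?_⟩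
    have := hw k
    rw [hc] at this
    exact (Option.some_injective _ this).symm

theorem exists_isOutput {G : ColouredGame V Γ} {ρ : ℕ → G.E}
    (h : ∃ᶠ k in Filter.atTop, G.colour (ρ k) ≠ none) : ∃ w, G.IsOutput ρ w := by
  have hinf : {i | G.colour (ρ i) ≠ none}.Infinite := Nat.frequently_atTop_iff_infinite.1 h
  have hc : ∀ k, ∃ c, G.colour (ρ (Nat.nth (fun i => G.colour (ρ i) ≠ none) k)) = some c :=
    fun k => Option.ne_none_iff_exists'.1 (Nat.nth_mem_of_infinite hinf k)
  choose w hw using hc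
  exact ⟨w, _, Nat.nth_strictMono hinf, Nat.range_nth_of_infinite hinf, hw⟩

/-- Winning for the pair condition, in terms of the colours of the play itself: erasing the
neutral letter can be left out of all further arguments. -/
theorem playWon_pairLanguage_iff [Finite Γ] {G : ColouredGame V Γ} {ρ : ℕ → G.E} :
    G.PlayWon (pairLanguage Γ) ρ ↔ ∃ a b, a ≠ b ∧
      (∃ᶠ k in Filter.atTop, G.colour (ρ k) = some a) ∧
      (∃ᶠ k in Filter.atTop, G.colour (ρ k) = some b) ∧
      ∀ᶠ k in Filter.atTop, ∀ c, G.colour (ρ k) = some c → c = a ∨ c = b := by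
  constructor
  · rintro ⟨w, hw, h2⟩
    change (infSet w).ncard = 2 at h2
    rw [infSet_of_isOutput hw, Set.ncard_eq_two] at h2
    obtain ⟨a, b, hab, h⟩ := h2
    have hiff : ∀ c, (∃ᶠ k in Filter.atTop, G.colour (ρ k) = some c) ↔ c = a ∨ c = b :=
      fun c => by simpa using Set.ext_iff.1 h c
    refine ⟨a, b, hab, (hiff a).2 (Or.inl rfl), (hiff b).2 (Or.inr rfl), ?_⟩
    rw [Filter.eventually_all]
    intro c
    by_cases hc : c = a ∨ c = b
    · exact Filter.Eventually.of_forall fun _ _ => hc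
    · rw [← hiff, Filter.not_frequently] at hc
      exact hc.mono fun k hk hk' => absurd hk' hk
  · rintro ⟨a, b, hab, ha, hb, h⟩
    have hne : ∃ᶠ k in Filter.atTop, G.colour (ρ k) ≠ none := ha.mono fun k hk => by simp [hk]
    obtain ⟨w, hw⟩ := exists_isOutput hne
    refine ⟨w, hw, ?_⟩
    change (infSet w).ncard = 2
    rw [infSet_of_isOutput hw, Set.ncard_eq_two]
    refine ⟨a, b, hab, ?_⟩
    ext c
    simp only [Set.mem_ofPred_eq, Set.mem_insert_iff, Set.mem_singleton_iff]
    constructor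
    · intro hc
      obtain ⟨k, hk, hk'⟩ := (hc.and_eventually h).exists
      exact hk' c hk
    · rintro (rfl | rfl) <;> assumption

theorem endOf_append {E : Set (V × V)} (v : V) (l l' : List E) :
    endOf v (l ++ l') = endOf (endOf v l) l' := by
  induction l generalizing v with
  | nil => rfl
  | cons e l ih => exact ih _

@[simp] theorem endOf_concat {E : Set (V × V)} (v : V) (l : List E) (e : E) :
    endOf v (l ++ [e]) = tgt e := by
  rw [endOf_append]; rfl

theorem isPath_append {E : Set (V × V)} (v : V) (l l' : List E) :
    IsPath v (l ++ l') ↔ IsPath v l ∧ IsPath (endOf v l) l' := by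
  induction l generalizing v with
  | nil => simp [IsPath, endOf]
  | cons e l ih => simp [IsPath, endOf, ih, and_assoc]

theorem pre_succ {E : Type*} (ρ : ℕ → E) (k : ℕ) : pre ρ (k + 1) = pre ρ k ++ [ρ k] := by
  simp [pre, List.range_succ]

theorem endOf_pre {G : ColouredGame V Γ} {ρ : ℕ → G.E} (hρ : G.IsPlay ρ) (k : ℕ) :
    endOf G.init (pre ρ k) = src (ρ k) := by
  cases k with
  | zero => exact hρ.1.symm
  | succ k => rw [pre_succ, endOf_concat, hρ.2]

/-- The histories that can arise when Eve follows `σ`. -/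
inductive Consistent (G : ColouredGame V Γ) (σ : List G.E → G.E) : List G.E → Prop
  | nil : Consistent G σ []
  | concat (h : List G.E) (e : G.E) : Consistent G σ h → src e = endOf G.init h →
      (endOf G.init h ∈ G.eve → e = σ h) → Consistent G σ (h ++ [e])

namespace Consistent

variable {G : ColouredGame V Γ} {σ : List G.E → G.E}

theorem of_concat {h : List G.E} {e : G.E} (H : Consistent G σ (h ++ [e])) :
    Consistent G σ h ∧ src e = endOf G.init h ∧ (endOf G.init h ∈ G.eve → e = σ h) := by
  generalize hx : h ++ [e] = x at H
  cases H with
  | nil => simp at hx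
  | concat h' e' h1 h2 h3 =>
    obtain ⟨rfl, he⟩ := List.append_inj' hx rfl
    obtain rfl : e = e' := by simpa using he
    exact ⟨h1, h2, h3⟩

theorem isPath {h : List G.E} (H : Consistent G σ h) : IsPath G.init h := by
  induction H with
  | nil => trivial
  | concat h e _ h2 _ ih => exact (isPath_append _ _ _).2 ⟨ih, h2, trivial⟩

theorem of_pre_le {ρ : ℕ → G.E} {k k' : ℕ} (hk : k ≤ k') (H : Consistent G σ (pre ρ k')) :
    Consistent G σ (pre ρ k) := by
  induction hk with
  | refl => exact H
  | step _ ih => rw [pre_succ] at H; exact ih H.of_concat.1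

/-- A play all of whose prefixes are consistent with `σ` adheres to `σ`. -/
theorem isPlay_and_adheres {ρ : ℕ → G.E} (H : ∀ k, Consistent G σ (pre ρ k)) :
    G.IsPlay ρ ∧ G.Adheres σ ρ := by
  have H' : ∀ k, _ := fun k => (pre_succ ρ k ▸ H (k + 1)).of_concat
  refine ⟨⟨(H' 0).2.1, fun i => ?_⟩, fun k => (H' k).2.2⟩
  rw [(H' (i + 1)).2.1, pre_succ, endOf_concat]

/-- An increasing sequence of consistent histories has a limit play. -/
theorem exists_play (h : ℕ → List G.E) (hc : ∀ k, Consistent G σ (h k))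
    (hs : ∀ k, ∃ l, l ≠ [] ∧ h (k + 1) = h k ++ l) :
    ∃ ρ, G.IsPlay ρ ∧ G.Adheres σ ρ ∧ ∀ k, h k = pre ρ (h k).length := by
  have hlen : StrictMono fun k => (h k).length := strictMono_nat_of_lt_succ fun k => by
    obtain ⟨l, hl, he⟩ := hs k
    simpa [he] using List.length_pos_iff.2 hl
  have hpre : ∀ {k k'}, k ≤ k' → h k <+: h k' := by
    intro k k' hk
    induction hk with
    | refl => exact List.prefix_rfl
    | step _ ih =>
      obtain ⟨l, _, he⟩ := hs _
      exact ih.trans (he ▸ List.prefix_append _ _)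
  have hlt : ∀ i, i < (h (i + 1)).length := fun i =>
    lt_of_lt_of_le (Nat.lt_succ_self i) (hlen.id_le (i + 1))
  have heq : ∀ k, h k = pre (fun i => (h (i + 1))[i]'(hlt i)) (h k).length := by
    intro k
    refine List.ext_getElem (by simp [pre]) fun i h1 h2 => ?_
    simp only [pre, List.getElem_map, List.getElem_range]
    rcases le_total k (i + 1) with hk | hk
    · exact (hpre hk).getElem h1
    · exact ((hpre hk).getElem (hlt i)).symm
  obtain ⟨hp, ha⟩ := isPlay_and_adheres (σ := σ) fun k =>
    of_pre_le (hlen.id_le k) (heq k ▸ hc k)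
  exact ⟨_, hp, ha, heq⟩

end Consistent

/-! ### The fixed point describing Eve's winning region -/

/-- The controllable predecessor: the vertices from which Eve can make sure that the next edge
belongs to `P`. -/
def cpre (G : ColouredGame V Γ) (P : Set G.E) : Set V :=
  {v | (v ∈ G.eve → ∃ e : G.E, src e = v ∧ e ∈ P) ∧
    (v ∉ G.eve → ∀ e : G.E, src e = v → e ∈ P)}

theorem cpre_mono (G : ColouredGame V Γ) {P Q : Set G.E} (h : P ⊆ Q) : G.cpre P ⊆ G.cpre Q :=
  fun _ hv => ⟨fun he => (hv.1 he).imp fun _ h' => ⟨h'.1, h h'.2⟩, fun he e hs => h (hv.2 he e hs)⟩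

/-- The edges that Eve is content with while she waits for the colour `c` of the pair `p`: they
lead to `Y`, or they respect the pair `p`, stay in `Z`, and have colour `c` or lead to `X`. -/
def goodEdges (G : ColouredGame V Γ) (p : Γ × Γ) (c : Γ) (Y Z X : Set V) : Set G.E :=
  {e | tgt e ∈ Y ∨ ((∀ d, G.colour e = some d → d = p.1 ∨ d = p.2) ∧ tgt e ∈ Z ∧
    (G.colour e = some c ∨ tgt e ∈ X))}

theorem goodEdges_mono (G : ColouredGame V Γ) (p : Γ × Γ) (c : Γ) {Y Z X Y' Z' X' : Set V}
    (hY : Y ⊆ Y') (hZ : Z ⊆ Z') (hX : X ⊆ X') :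
    G.goodEdges p c Y Z X ⊆ G.goodEdges p c Y' Z' X' := by
  rintro e (h | ⟨h1, h2, h3⟩)
  · exact Or.inl (hY h)
  · exact Or.inr ⟨h1, hZ h2, h3.imp id fun h => hX h⟩

/-- One step of the attraction to the colour `c` of the pair `p`, or to `Y`, within `Z`. -/
def attrStep (G : ColouredGame V Γ) (p : Γ × Γ) (c : Γ) (Y Z : Set V) : Set V →o Set V where
  toFun X := G.cpre (G.goodEdges p c Y Z X)
  monotone' _ _ h := G.cpre_mono (G.goodEdges_mono p c subset_rfl subset_rfl h)

/-- The vertices from which Eve can force the colour `c` of the pair `p`, or a visit to `Y`,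
without leaving `Z` or seeing colours outside `p` before. -/
def attr (G : ColouredGame V Γ) (p : Γ × Γ) (c : Γ) (Y Z : Set V) : Set V :=
  (G.attrStep p c Y Z).lfp

theorem attr_mono (G : ColouredGame V Γ) (p : Γ × Γ) (c : Γ) {Y Z Y' Z' : Set V}
    (hY : Y ⊆ Y') (hZ : Z ⊆ Z') : G.attr p c Y Z ⊆ G.attr p c Y' Z' :=
  OrderHom.lfp.mono (show G.attrStep p c Y Z ≤ G.attrStep p c Y' Z' from fun _ =>
    G.cpre_mono (G.goodEdges_mono p c hY hZ subset_rfl))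

/-- One step of the computation of `trap`. -/
def trapStep (G : ColouredGame V Γ) (p : Γ × Γ) (Y : Set V) : Set V →o Set V where
  toFun Z := G.attr p p.1 Y Z ∩ G.attr p p.2 Y Z
  monotone' _ _ h := Set.inter_subset_inter (G.attr_mono p _ subset_rfl h)
    (G.attr_mono p _ subset_rfl h)

/-- The vertices from which Eve can force that either `Y` is visited, or both colours of `p`
occur infinitely often and no other colour occurs. -/
def trap (G : ColouredGame V Γ) (p : Γ × Γ) (Y : Set V) : Set V := (G.trapStep p Y).gfp

theorem trap_mono (G : ColouredGame V Γ) (p : Γ × Γ) {Y Y' : Set V} (h : Y ⊆ Y') :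
    G.trap p Y ⊆ G.trap p Y' :=
  OrderHom.gfp.mono (show G.trapStep p Y ≤ G.trapStep p Y' from fun _ =>
    Set.inter_subset_inter (G.attr_mono p _ h subset_rfl) (G.attr_mono p _ h subset_rfl))

theorem trap_subset_attr (G : ColouredGame V Γ) (p : Γ × Γ) (Y : Set V) {c : Γ}
    (hc : c = p.1 ∨ c = p.2) : G.trap p Y ⊆ G.attr p c Y (G.trap p Y) := by
  intro v hv
  have h : v ∈ G.trapStep p Y (G.trap p Y) := by
    rw [trap, OrderHom.map_gfp]; exact hv
  rcases hc with rfl | rfl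
  exacts [h.1, h.2]

theorem subset_trap (G : ColouredGame V Γ) (p : Γ × Γ) {Y Z : Set V}
    (h1 : Z ⊆ G.attr p p.1 Y Z) (h2 : Z ⊆ G.attr p p.2 Y Z) : Z ⊆ G.trap p Y :=
  OrderHom.le_gfp (G.trapStep p Y) fun _ hv => ⟨h1 hv, h2 hv⟩

/-- One more layer of Eve's winning region: choose a pair of colours, and force that pair, unless
the layers `Y` already known to be winning are visited. -/
def regionStep (G : ColouredGame V Γ) : Set V →o Set V where
  toFun Y := {v | ∃ p : Γ × Γ, p.1 ≠ p.2 ∧ v ∈ G.trap p Y}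
  monotone' _ _ h _ := fun ⟨p, hp, hv⟩ => ⟨p, hp, G.trap_mono p h hv⟩

/-- Eve's winning region, as an iterated fixed point. -/
def region (G : ColouredGame V Γ) : Set V := G.regionStep.lfp

/-! ### Two memory states suffice on the fixed point -/

/-- The colour of the pair `p` for which Eve waits in the memory state `m`. -/
def awaited (p : Γ × Γ) (m : Fin 2) : Γ := if m = 0 then p.1 else p.2

theorem awaited_mem (p : Γ × Γ) (m : Fin 2) : awaited p m = p.1 ∨ awaited p m = p.2 := by
  unfold awaited; split_ifs <;> simp

/-- The winning region is stratified by a level, which never increases when Eve plays well and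
determines a pair of colours; as long as the level is constant, only colours of that pair occur,
and a rank decreases until the awaited colour occurs. -/
theorem exists_layers [Countable Γ] [Nonempty Γ] (G : ColouredGame V Γ) :
    ∃ (lev : V → Ordinal.{u} ×ₗ ℕ) (p : Ordinal.{u} ×ₗ ℕ → Γ × Γ)
      (s : Ordinal.{u} ×ₗ ℕ → Γ → V → Ordinal.{u}),
    ∀ v ∈ G.region, (p (lev v)).1 ≠ (p (lev v)).2 ∧ ∀ c, c = (p (lev v)).1 ∨ c = (p (lev v)).2 →
      v ∈ G.cpre {e | tgt e ∈ G.region ∧ (lev (tgt e) < lev v ∨ (lev (tgt e) = lev v ∧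
        (∀ d, G.colour e = some d → d = (p (lev v)).1 ∨ d = (p (lev v)).2) ∧
        (G.colour e = some c ∨ s (lev v) c (tgt e) < s (lev v) c v)))} := by
  classical
  obtain ⟨r, hr, hrle⟩ := exists_rank_of_lfp G.regionStep
  change ∀ v ∈ G.region, v ∈ G.regionStep {u | u ∈ G.region ∧ r u < r v} at hr
  change ∀ v a, v ∈ G.regionStep {u | u ∈ G.region ∧ r u < a} → r v ≤ a at hrle
  obtain ⟨key, hkey⟩ := exists_injective_nat (Γ × Γ)
  let Y : Ordinal.{u} → Set V := fun a => {u | u ∈ G.region ∧ r u < a}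
  -- Among the possible pairs the least one is chosen, so that the pair cannot change for ever.
  have hpair : ∀ v, ∃ p : Γ × Γ, v ∈ G.region → (p.1 ≠ p.2 ∧ v ∈ G.trap p (Y (r v))) ∧
      ∀ q : Γ × Γ, q.1 ≠ q.2 → v ∈ G.trap q (Y (r v)) → key p ≤ key q := by
    intro v
    by_cases hv : v ∈ G.region
    · obtain ⟨p, hp⟩ := hr v hv
      let S : Set ℕ := key '' {q | q.1 ≠ q.2 ∧ v ∈ G.trap q (Y (r v))}
      obtain ⟨q, hq, hqS⟩ : sInf S ∈ S := Nat.sInf_mem ⟨_, p, hp, rfl⟩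
      exact ⟨q, fun _ => ⟨hq, fun q' h1 h2 => hqS ▸ Nat.sInf_le ⟨q', ⟨h1, h2⟩, rfl⟩⟩⟩
    · exact ⟨Classical.arbitrary _, fun h => absurd h hv⟩
  choose p hp using hpair
  have hs : ∀ (a : Ordinal.{u}) (q : Γ × Γ) (c : Γ), ∃ s : V → Ordinal.{u},
      ∀ v ∈ G.attr q c (Y a) (G.trap q (Y a)),
        v ∈ G.cpre (G.goodEdges q c (Y a) (G.trap q (Y a))
          {u | u ∈ G.attr q c (Y a) (G.trap q (Y a)) ∧ s u < s v}) :=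
    fun a q c => (exists_rank_of_lfp (G.attrStep q c (Y a) (G.trap q (Y a)))).imp
      fun _ h => h.1
  choose s hs using hs
  let dec : ℕ → Γ × Γ := Function.invFun key
  have hdec : ∀ q, dec (key q) = q := Function.leftInverse_invFun hkey
  refine ⟨fun v => toLex (r v, key (p v)), fun a => dec (ofLex a).2,
    fun a c => s (ofLex a).1 (dec (ofLex a).2) c, fun v hv => ?_⟩
  simp only [ofLex_toLex, hdec]
  refine ⟨(hp v hv).1.1, fun c hc => G.cpre_mono ?_
    (hs (r v) (p v) c v (G.trap_subset_attr _ _ hc (hp v hv).1.2))⟩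
  rintro e (⟨h1, h2⟩ | ⟨h1, h2, h3⟩)
  · exact ⟨h1, Or.inl (Prod.Lex.toLex_lt_toLex.2 (Or.inl h2))⟩
  · have hregion : tgt e ∈ G.region := by
      have : tgt e ∈ G.regionStep G.region :=
        ⟨p v, (hp v hv).1.1, G.trap_mono _ (fun _ h => h.1) h2⟩
      rwa [region, OrderHom.map_lfp] at this
    have hle : r (tgt e) ≤ r v := hrle _ _ ⟨p v, (hp v hv).1.1, h2⟩
    refine ⟨hregion, ?_⟩
    rcases hle.lt_or_eq with hlt | heq
    · exact Or.inl (Prod.Lex.toLex_lt_toLex.2 (Or.inl hlt))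
    · have hk : key (p (tgt e)) ≤ key (p v) :=
        (hp _ hregion).2 _ (hp v hv).1.1 (heq ▸ h2)
      rcases hk.lt_or_eq with hlt | hkeq
      · exact Or.inl (Prod.Lex.toLex_lt_toLex.2 (Or.inr ⟨heq, hlt⟩))
      · exact Or.inr ⟨by rw [heq, hkeq], h1, h3.imp id And.right⟩

/-- On the fixed point Eve wins with two memory states: the state says which colour of the pair
of the current level she waits for. -/
theorem eveWinsWithMemory_two_of_mem_region [Finite Γ] [Nonempty Γ] {G : ColouredGame V Γ}
    (hG : G.init ∈ G.region) : G.EveWinsWithMemory (pairLanguage Γ) 2 := by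
  classical
  obtain ⟨lev, p, s, H⟩ := G.exists_layers
  let w : V → Fin 2 → Γ := fun v m => awaited (p (lev v)) m
  let P : V → Fin 2 → Set G.E := fun v m =>
    {e | tgt e ∈ G.region ∧ (lev (tgt e) < lev v ∨ (lev (tgt e) = lev v ∧
        (∀ d, G.colour e = some d → d = (p (lev v)).1 ∨ d = (p (lev v)).2) ∧
        (G.colour e = some (w v m) ∨ s (lev v) (w v m) (tgt e) < s (lev v) (w v m) v)))}
  have HP : ∀ v ∈ G.region, ∀ m, v ∈ G.cpre (P v m) := fun v hv m =>
    (H v hv).2 _ (awaited_mem _ m)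
  have hnext : ∀ v m, ∃ e : G.E, src e = v ∧ (v ∈ G.region → v ∈ G.eve → e ∈ P v m) := by
    intro v m
    by_cases h : v ∈ G.region ∧ v ∈ G.eve
    · obtain ⟨e, he, heP⟩ := (HP v h.1 m).1 h.2
      exact ⟨e, he, fun _ _ => heP⟩
    · obtain ⟨e, he⟩ := G.exists_edge v
      exact ⟨e, he, fun h1 h2 => absurd ⟨h1, h2⟩ h⟩
  choose next hsrc hnext using hnext
  let M : G.Memory (Fin 2) :=
    { init := 0
      update := fun m e => if G.colour e = some (w (src e) m) then 1 - m else m }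
  refine ⟨M, next, fun v _ m => hsrc v m, fun h _ _ => hsrc _ _, fun ρ hρ hadh => ?_⟩
  let v : ℕ → V := fun k => src (ρ k)
  let q : ℕ → Fin 2 := fun k => (pre ρ k).foldl M.update M.init
  have hq : ∀ k, q (k + 1) = if G.colour (ρ k) = some (w (v k) (q k)) then 1 - q k else q k := by
    intro k
    simp only [q, pre_succ, List.foldl_append, List.foldl_cons, List.foldl_nil]
    rfl
  have hv : ∀ k, v (k + 1) = tgt (ρ k) := hρ.2
  have hstep : ∀ k, v k ∈ G.region → ρ k ∈ P (v k) (q k) := by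
    intro k hk
    by_cases he : v k ∈ G.eve
    · have h1 := hadh k
      simp only [Memory.strategy, endOf_pre hρ] at h1
      rw [h1 he]
      exact hnext _ _ hk he
    · exact (HP _ hk _).2 he _ rfl
  have hreg : ∀ k, v k ∈ G.region := by
    intro k
    induction k with
    | zero => simpa only [v, hρ.1] using hG
    | succ k ih => rw [hv]; exact (hstep k ih).1
  obtain ⟨K, hK⟩ := eventually_const_of_antitone (fun k => lev (v k)) fun k => by
    rw [hv]
    exact (hstep k (hreg k)).2.elim le_of_lt fun h => h.1.le
  have hlate : ∀ k ≥ K, (∀ d, G.colour (ρ k) = some d →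
      d = (p (lev (v K))).1 ∨ d = (p (lev (v K))).2) ∧
      (G.colour (ρ k) = some (awaited (p (lev (v K))) (q k)) ∨
        s (lev (v K)) (awaited (p (lev (v K))) (q k)) (v (k + 1)) <
        s (lev (v K)) (awaited (p (lev (v K))) (q k)) (v k)) := by
    intro k hk
    have h1 : lev (v (k + 1)) = lev (v k) := (hK (k + 1) (hk.trans (Nat.le_succ k))).trans
      (hK k hk).symm
    rcases (hstep k (hreg k)).2 with h | ⟨_, h⟩
    · rw [← hv, h1] at h
      exact absurd h (lt_irrefl _)
    · simpa only [w, hK k hk, hv] using h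
  -- The awaited colour occurs, because the rank cannot decrease for ever.
  have hocc : ∀ k ≥ K, ∃ k' ≥ k, q k' = q k ∧
      G.colour (ρ k') = some (awaited (p (lev (v K))) (q k)) := by
    intro k hk
    generalize ho : s (lev (v K)) (awaited (p (lev (v K))) (q k)) (v k) = o
    induction o using WellFoundedLT.induction generalizing k with
    | ind o ih =>
      by_cases hc : G.colour (ρ k) = some (awaited (p (lev (v K))) (q k))
      · exact ⟨k, le_rfl, rfl, hc⟩
      · have hq' : q (k + 1) = q k := by
          rw [hq, if_neg]
          simpa only [w, hK k hk] using hc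
        obtain ⟨k', h1, h2, h3⟩ := ih _ (ho ▸ ((hlate k hk).2.resolve_left hc)) (k + 1)
          (hk.trans (Nat.le_succ k)) (by rw [hq'])
        exact ⟨k', (Nat.le_succ k).trans h1, h2.trans hq', hq' ▸ h3⟩
  have hboth : ∀ m : Fin 2, ∃ᶠ k in Filter.atTop,
      G.colour (ρ k) = some (awaited (p (lev (v K))) m) := by
    intro m
    rw [Filter.frequently_atTop]
    intro a
    obtain ⟨k, h1, h2, h3⟩ := hocc (max a K) (le_max_right _ _)
    have hka : a ≤ k := (le_max_left _ _).trans h1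
    by_cases hm : q (max a K) = m
    · exact ⟨k, hka, hm ▸ h3⟩
    · have hkK : K ≤ k := (le_max_right _ _).trans h1
      have hq' : q (k + 1) = m := by
        rw [hq, if_pos (by simpa only [w, hK k hkK, h2] using h3), h2]
        omega
      obtain ⟨k', h1', _, h3'⟩ := hocc (k + 1) (hkK.trans (Nat.le_succ k))
      exact ⟨k', hka.trans ((Nat.le_succ k).trans h1'), hq' ▸ h3'⟩
  refine playWon_pairLanguage_iff.2 ⟨_, _, (H _ (hreg K)).1, hboth 0, hboth 1, ?_⟩
  exact Filter.eventually_atTop.2 ⟨K, fun k hk => (hlate k hk).1⟩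

/-! ### A winning strategy only visits the fixed point -/

/-- A countable type has an enumeration that takes every value infinitely often. -/
theorem exists_frequently_eq (α : Type*) [Countable α] [Nonempty α] :
    ∃ g : ℕ → α, ∀ a N, ∃ k ≥ N, g k = a := by
  obtain ⟨f, hf⟩ := exists_surjective_nat α
  refine ⟨fun k => f (Nat.unpair k).1, fun a N => ?_⟩
  obtain ⟨i, rfl⟩ := hf a
  exact ⟨Nat.pair i N, Nat.right_le_pair i N, by simp⟩

/-- If, after the history `h`, the winning strategy `σ` only produces colours of the pair `p` as
long as the region is avoided, then `σ` witnesses that `h` ends in the trap for `p`. -/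
theorem mem_trap_of_consistent [Finite Γ] {G : ColouredGame V Γ} {σ : List G.E → G.E}
    (hσ : G.IsWinningStrategy (pairLanguage Γ) σ) (p : Γ × Γ) (L : Set V)
    {h : List G.E} (hh : Consistent G σ h) (hL : endOf G.init h ∉ L)
    (hp : ∀ l, Consistent G σ (h ++ l) → endOf G.init (h ++ l) ∉ L →
      ∀ e ∈ l, ∀ d, G.colour e = some d → d = p.1 ∨ d = p.2) :
    endOf G.init h ∈ G.trap p L := by
  let Z : Set V := {z | ∃ l, Consistent G σ (h ++ l) ∧ endOf G.init (h ++ l) = z ∧ z ∉ L}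
  have key : ∀ c, c = p.1 ∨ c = p.2 → Z ⊆ G.attr p c L Z := by
    rintro c hc z ⟨l, hl, hlz, hzL⟩
    by_contra hz
    let T := {l' : List G.E // Consistent G σ (h ++ l') ∧ endOf G.init (h ++ l') ∉ L ∧
      endOf G.init (h ++ l') ∉ G.attr p c L Z}
    have hattr : ∀ {x : V}, x ∈ G.cpre (G.goodEdges p c L Z (G.attr p c L Z)) →
        x ∈ G.attr p c L Z := by
      intro x hx
      rw [attr, ← OrderHom.map_lfp]
      exact hx
    -- Outside the attractor the play goes on for one more step without the colour `c`.
    have hstep : ∀ t : T, ∃ t' : T, ∃ e, t'.1 = t.1 ++ [e] ∧ G.colour e ≠ some c ∧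
        ∀ d, G.colour e = some d → d = p.1 ∨ d = p.2 := by
      rintro ⟨l', h1, h2, h3⟩
      obtain ⟨e, he1, he2, he3⟩ : ∃ e : G.E, src e = endOf G.init (h ++ l') ∧
          (endOf G.init (h ++ l') ∈ G.eve → e = σ (h ++ l')) ∧
          e ∉ G.goodEdges p c L Z (G.attr p c L Z) := by
        by_contra! hcon
        refine h3 (hattr ⟨fun hE => ⟨σ (h ++ l'), hσ.1 _ h1.isPath hE, ?_⟩, fun hA e he => ?_⟩)
        · exact hcon _ (hσ.1 _ h1.isPath hE) fun _ => rfl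
        · exact hcon e he fun hE => absurd hE hA
      have hcons : Consistent G σ (h ++ (l' ++ [e])) := by
        rw [← List.append_assoc]
        exact .concat _ _ h1 he1 he2
      have hend : endOf G.init (h ++ (l' ++ [e])) = tgt e := by
        rw [← List.append_assoc, endOf_concat]
      have heL : tgt e ∉ L := fun h' => he3 (Or.inl h')
      have hcol : ∀ d, G.colour e = some d → d = p.1 ∨ d = p.2 :=
        hp _ hcons (hend ▸ heL) e (by simp)
      have heZ : tgt e ∈ Z := ⟨_, hcons, hend, heL⟩
      refine ⟨⟨l' ++ [e], hcons, hend ▸ heL, hend ▸ fun h' => he3 (Or.inr ⟨hcol, heZ, Or.inr h'⟩)⟩,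
        e, rfl, fun h' => he3 (Or.inr ⟨hcol, heZ, Or.inl h'⟩), hcol⟩
    choose f g hf1 hf2 hf3 using hstep
    let t : ℕ → T := fun k => f^[k] ⟨l, hl, hlz ▸ hzL, hlz ▸ hz⟩
    have ht : ∀ k, (t (k + 1)).1 = (t k).1 ++ [g (t k)] := fun k => by
      simp only [t, Function.iterate_succ_apply']
      exact hf1 _
    obtain ⟨ρ, hρ1, hρ2, hρ3⟩ := Consistent.exists_play (fun k => h ++ (t k).1)
      (fun k => (t k).2.1) (fun k => ⟨[g (t k)], by simp, by simp [ht]⟩)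
    have hlen : ∀ k, (h ++ (t k).1).length = (h ++ (t 0).1).length + k := by
      intro k
      induction k with
      | zero => rfl
      | succ k ih => rw [ht, ← List.append_assoc, List.length_append, ih]; rfl
    have hρ : ∀ k, ρ ((h ++ (t 0).1).length + k) = g (t k) := by
      intro k
      have h1 := hρ3 (k + 1)
      rw [hlen, ← add_assoc, pre_succ, ← hlen, ← hρ3 k, ht, ← List.append_assoc] at h1
      rw [← hlen]
      exact (List.singleton_injective (List.append_cancel_left h1)).symm
    have hev : ∀ᶠ i in Filter.atTop, G.colour (ρ i) ≠ some c ∧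
        ∀ d, G.colour (ρ i) = some d → d = p.1 ∨ d = p.2 := by
      refine Filter.eventually_atTop.2 ⟨(h ++ (t 0).1).length, fun i hi => ?_⟩
      obtain ⟨k, rfl⟩ := Nat.exists_eq_add_of_le hi
      rw [hρ]
      exact ⟨hf2 _, hf3 _⟩
    obtain ⟨a, b, hab, ha, hb, -⟩ := playWon_pairLanguage_iff.1 (hσ.2 ρ hρ1 hρ2)
    obtain ⟨i, hi1, hi2, hi3⟩ := (ha.and_eventually hev).exists
    obtain ⟨j, hj1, hj2, hj3⟩ := (hb.and_eventually hev).exists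
    have h1 : a ≠ c := fun h' => hi2 (h' ▸ hi1)
    have h2 : b ≠ c := fun h' => hj2 (h' ▸ hj1)
    have h3 := hi3 a hi1
    have h4 := hj3 b hj1
    grind
  exact G.subset_trap p (key _ (Or.inl rfl)) (key _ (Or.inr rfl))
    ⟨[], by simpa using hh, by simp, hL⟩

/-- Eve can only win from the fixed point: otherwise some play consistent with her winning
strategy would leave each pair of colours infinitely often. -/
theorem init_mem_region_of_eveWins [Finite Γ] [Nontrivial Γ] {G : ColouredGame V Γ}
    (hG : G.EveWins (pairLanguage Γ)) : G.init ∈ G.region := by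
  obtain ⟨σ, hσ⟩ := hG
  by_contra hinit
  let T := {h : List G.E // Consistent G σ h ∧ endOf G.init h ∉ G.region}
  have hstep : ∀ (t : T) (p : {p : Γ × Γ // p.1 ≠ p.2}), ∃ (t' : T) (l : List G.E),
      t'.1 = t.1 ++ l ∧ ∃ e ∈ l, ∃ d, G.colour e = some d ∧ d ≠ p.1.1 ∧ d ≠ p.1.2 := by
    rintro ⟨h, hh, hL⟩ p
    by_contra! hcon
    have htrap : endOf G.init h ∈ G.trap p.1 G.region := by
      refine mem_trap_of_consistent hσ p.1 G.region hh hL fun l h1 h2 e he d hd => ?_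
      by_contra! hd'
      exact hd'.2 (hcon ⟨h ++ l, h1, h2⟩ l rfl e he d hd hd'.1)
    refine hL ?_
    rw [region, ← OrderHom.map_lfp]
    exact ⟨p.1, p.2, htrap⟩
  choose f l hl hcol using hstep
  obtain ⟨a₀, b₀, hab₀⟩ := exists_pair_ne Γ
  have : Nonempty {p : Γ × Γ // p.1 ≠ p.2} := ⟨⟨(a₀, b₀), hab₀⟩⟩
  obtain ⟨g, hg⟩ := exists_frequently_eq {p : Γ × Γ // p.1 ≠ p.2}
  let t : ℕ → T := fun k => Nat.rec ⟨[], .nil, hinit⟩ (fun i t => f t (g i)) k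
  have ht : ∀ k, (t (k + 1)).1 = (t k).1 ++ l (t k) (g k) := fun k => hl _ _
  obtain ⟨ρ, hρ1, hρ2, hρ3⟩ := Consistent.exists_play (fun k => (t k).1) (fun k => (t k).2.1)
    fun k => ⟨_, List.ne_nil_of_mem (hcol (t k) (g k)).choose_spec.1, ht k⟩
  have hlen : ∀ k, k ≤ (t k).1.length := by
    intro k
    induction k with
    | zero => exact Nat.zero_le _
    | succ k ih =>
      rw [ht, List.length_append]
      exact Nat.add_le_add ih (List.length_pos_iff.2
        (List.ne_nil_of_mem (hcol (t k) (g k)).choose_spec.1))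
  obtain ⟨a, b, hab, -, -, h⟩ := playWon_pairLanguage_iff.1 (hσ.2 ρ hρ1 hρ2)
  obtain ⟨N, hN⟩ := Filter.eventually_atTop.1 h
  obtain ⟨k, hk, hgk⟩ := hg ⟨(a, b), hab⟩ N
  obtain ⟨e, he, d, hd, hda, hdb⟩ := hcol (t k) (g k)
  rw [hgk] at hda hdb
  obtain ⟨i, hi, rfl⟩ := List.getElem_of_mem he
  have hlt : (t k).1.length + i < (t (k + 1)).1.length := by
    rw [ht, List.length_append]; omega
  have hval : ρ ((t k).1.length + i) = (l (t k) (g k))[i] := by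
    have h1 : (t (k + 1)).1[(t k).1.length + i] = ρ ((t k).1.length + i) := by
      simp only [List.getElem_of_eq (hρ3 (k + 1)) hlt, pre, List.getElem_map,
        List.getElem_range]
    rw [← h1, List.getElem_of_eq (ht k) hlt, List.getElem_append_right (Nat.le_add_right _ _)]
    simp
  rw [← hval] at hd
  exact (hN _ ((hk.trans (hlen k)).trans (Nat.le_add_right _ _)) d hd).elim hda hdb

theorem eveWinsWithMemory_two [Finite Γ] [Nontrivial Γ] {G : ColouredGame V Γ}
    (hG : G.EveWins (pairLanguage Γ)) : G.EveWinsWithMemory (pairLanguage Γ) 2 :=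
  eveWinsWithMemory_two_of_mem_region (init_mem_region_of_eveWins hG)

/-! ### A game that separates chromatic memory from general memory -/

/-- The vertices of the petal game. After `start`, Adam fixes a pair `(i, j)`; the petal
`petal i j b` is a path on which the colour `i` (if `b` is true) or `j` (otherwise) is read,
and at `hub i j` Eve chooses the next petal. -/
inductive PetalVertex (n N : ℕ) : Type
  | start : PetalVertex n N
  | hub (i j : Fin n) : PetalVertex n N
  | petal (i j : Fin n) (b : Bool) (t : Fin (N + 1)) : PetalVertex n N
  deriving Fintype

namespace PetalVertex

variable {n N : ℕ}

/-- The colour read on the petal `petal i j b`. -/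
def sel (i j : Fin n) (b : Bool) : Fin n := if b then i else j

/-- The edges of the petal game. -/
inductive Step : PetalVertex n N → PetalVertex n N → Prop
  | start {i j : Fin n} (h : i ≠ j) (b : Bool) : Step start (petal i j b 0)
  | next (i j : Fin n) (b : Bool) (t : Fin N) : Step (petal i j b t.castSucc) (petal i j b t.succ)
  | back (i j : Fin n) (b : Bool) : Step (petal i j b (Fin.last N)) (hub i j)
  | choose (i j : Fin n) (b : Bool) : Step (hub i j) (petal i j b 0)

/-- The colour of an edge is the colour of the petal to which one of its ends belongs. (The value
for pairs of vertices outside the petals is irrelevant.) -/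
def edgeColour [NeZero n] : PetalVertex n N → PetalVertex n N → Fin n
  | petal i j b _, _ => sel i j b
  | _, petal i j b _ => sel i j b
  | _, _ => 0

end PetalVertex

open PetalVertex

/-- The petal game: a traversal of a petal reads `N + 2` times the same colour, the edges from and
to the hub included. -/
def petalGame (n N : ℕ) (hn : 2 ≤ n) : ColouredGame (PetalVertex n N) (Fin n) where
  eve := {v | ∃ i j, v = hub i j}
  E := {e | Step e.1 e.2}
  init := start
  colour e := haveI : NeZero n := ⟨by omega⟩; some (edgeColour e.1.1 e.1.2)
  exists_edge v := by
    cases v with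
    | start =>
      have hne : (⟨0, by omega⟩ : Fin n) ≠ ⟨1, by omega⟩ := by simp
      exact ⟨⟨(_, _), .start hne true⟩, rfl⟩
    | hub i j => exact ⟨⟨(_, _), .choose i j true⟩, rfl⟩
    | petal i j b t =>
      induction t using Fin.lastCases with
      | last => exact ⟨⟨(_, _), .back i j b⟩, rfl⟩
      | cast t => exact ⟨⟨(_, _), .next i j b t⟩, rfl⟩
  no_eps_cycle v l hl _ _ := by
    obtain ⟨e, he⟩ := List.exists_mem_of_ne_nil l hl
    exact ⟨e, he, by simp⟩

section PetalGame

variable {n N : ℕ} {hn : 2 ≤ n}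

theorem petalGame_epsFree : (petalGame n N hn).EpsFree := fun _ => by simp [petalGame]

theorem colour_of_src {e : (petalGame n N hn).E} {i j : Fin n} {b : Bool} {t : Fin (N + 1)}
    (h : src e = petal i j b t) : (petalGame n N hn).colour e = some (sel i j b) := by
  obtain ⟨⟨u, v⟩, he⟩ := e
  obtain rfl : u = _ := h
  rfl

theorem colour_of_tgt {e : (petalGame n N hn).E} {i j : Fin n} {b : Bool}
    (h : tgt e = petal i j b 0) : (petalGame n N hn).colour e = some (sel i j b) := by
  obtain ⟨⟨u, v⟩, he⟩ := e
  obtain rfl : v = _ := h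
  cases u with
  | start => rfl
  | hub => rfl
  | petal i' j' b' t' =>
    generalize hz : (0 : Fin (N + 1)) = z at he
    cases he with
    | next _ _ _ t => exact absurd hz.symm (Fin.succ_ne_zero t)

theorem tgt_of_src_start {e : (petalGame n N hn).E} (h : src e = start) :
    ∃ i j, i ≠ j ∧ ∃ b, tgt e = petal i j b 0 := by
  obtain ⟨⟨u, v⟩, he⟩ := e
  obtain rfl : u = _ := h
  cases he with
  | start h b => exact ⟨_, _, h, b, rfl⟩

theorem tgt_of_src_hub {e : (petalGame n N hn).E} {i j : Fin n} (h : src e = hub i j) :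
    ∃ b, tgt e = petal i j b 0 := by
  obtain ⟨⟨u, v⟩, he⟩ := e
  obtain rfl : u = _ := h
  cases he with
  | choose _ _ b => exact ⟨b, rfl⟩

theorem tgt_of_src_petal {e : (petalGame n N hn).E} {i j : Fin n} {b : Bool} {t : Fin (N + 1)}
    (h : src e = petal i j b t) :
    (∃ h : t.1 + 1 < N + 1, tgt e = petal i j b ⟨t.1 + 1, h⟩) ∨ (t.1 = N ∧ tgt e = hub i j) := by
  obtain ⟨⟨u, v⟩, he⟩ := e
  obtain rfl : u = _ := h
  cases he with
  | next _ _ _ t => exact Or.inl ⟨t.succ.2, rfl⟩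
  | back => exact Or.inr ⟨rfl, rfl⟩

/-- Memorizing the last colour is enough to win the petal game: at each hub Eve chooses the petal
with the other colour. -/
theorem petalGame_eveWinsWithChromaticMemory :
    (petalGame n N hn).EveWinsWithChromaticMemory (pairLanguage (Fin n)) n := by
  classical
  let G := petalGame n N hn
  have hnext : ∀ (v : PetalVertex n N) (m : Fin n), ∃ e : G.E, src e = v ∧
      ∀ i j, v = hub i j → tgt e = petal i j (decide (m ≠ i)) 0 := by
    intro v m
    by_cases hv : ∃ i j, v = hub i j
    · obtain ⟨i, j, rfl⟩ := hv
      refine ⟨⟨(_, _), .choose i j (decide (m ≠ i))⟩, rfl, fun i' j' h => ?_⟩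
      cases h
      rfl
    · obtain ⟨e, he⟩ := G.exists_edge v
      exact ⟨e, he, fun i j h => absurd ⟨i, j, h⟩ hv⟩
  choose next hsrc hnext using hnext
  let M : G.Memory (Fin n) :=
    { init := ⟨0, by omega⟩
      update := fun m e => (G.colour e).getD m }
  have hchrom : M.IsChromatic :=
    ⟨fun _ c => c, fun m e => ⟨fun c hc => by simp [M, hc], fun hc => by simp [M, hc]⟩⟩
  refine ⟨M, hchrom, next, fun v _ m => hsrc v m, fun h _ _ => hsrc _ _, fun ρ hρ hadh => ?_⟩
  let v : ℕ → PetalVertex n N := fun k => src (ρ k)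
  let q : ℕ → Fin n := fun k => (pre ρ k).foldl M.update M.init
  have hv : ∀ k, v (k + 1) = tgt (ρ k) := hρ.2
  have hq : ∀ k c, G.colour (ρ k) = some c → q (k + 1) = c := by
    intro k c hc
    simp only [q, pre_succ, List.foldl_append, List.foldl_cons, List.foldl_nil]
    simp [M, hc]
  have hmove : ∀ k i j, v k = hub i j → v (k + 1) = petal i j (decide (q k ≠ i)) 0 := by
    intro k i j hk
    have h1 := hadh k
    simp only [Memory.strategy, endOf_pre hρ] at h1
    rw [hv, h1 ⟨i, j, hk⟩]
    exact hnext _ _ i j hk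
  obtain ⟨i, j, hij, b, h1⟩ := tgt_of_src_start hρ.1
  rw [← hv] at h1
  have hsel : ∀ b, decide (sel i j b ≠ i) = !b := by
    intro b; cases b <;> simp [sel, hij.symm]
  -- Each petal is traversed, and the other one is entered afterwards.
  have hflip : ∀ d k b (t : Fin (N + 1)), N - t.1 = d → v k = petal i j b t →
      ∃ k' > k, v k' = petal i j (!b) 0 := by
    intro d
    induction d with
    | zero =>
      intro k b t hd hk
      have hc := hq k _ (colour_of_src hk)
      rcases tgt_of_src_petal hk with ⟨h, _⟩ | ⟨_, h⟩
      · omega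
      · rw [← hv] at h
        refine ⟨k + 2, by omega, ?_⟩
        rw [hmove (k + 1) i j h, hc, hsel]
    | succ d ih =>
      intro k b t hd hk
      rcases tgt_of_src_petal hk with ⟨h, h'⟩ | ⟨h, _⟩
      · rw [← hv] at h'
        obtain ⟨k', hk', hk''⟩ := ih (k + 1) b _ (by simp only; omega) h'
        exact ⟨k', by omega, hk''⟩
      · omega
  have hpetal : ∀ a, ∃ k ≥ a, ∃ b, v k = petal i j b 0 := by
    intro a
    induction a with
    | zero => exact ⟨1, by omega, b, h1⟩
    | succ a ih =>
      obtain ⟨k, hk, b, hb⟩ := ih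
      obtain ⟨k', hk', h'⟩ := hflip _ k b 0 rfl hb
      exact ⟨k', by omega, _, h'⟩
  have hfreq : ∀ b, ∃ᶠ k in Filter.atTop, G.colour (ρ k) = some (sel i j b) := by
    intro b
    rw [Filter.frequently_atTop]
    intro a
    obtain ⟨k, hk, b', hb'⟩ := hpetal a
    by_cases hbb : b' = b
    · exact ⟨k, hk, hbb ▸ colour_of_src hb'⟩
    · obtain ⟨k', hk', h'⟩ := hflip _ k b' 0 rfl hb'
      have : (!b') = b := by cases b <;> cases b' <;> simp_all
      exact ⟨k', by omega, colour_of_src (this ▸ h')⟩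
  have hinv : ∀ k, v (k + 1) = hub i j ∨ ∃ b t, v (k + 1) = petal i j b t := by
    intro k
    induction k with
    | zero => exact Or.inr ⟨_, _, h1⟩
    | succ k ih =>
      rcases ih with h | ⟨b, t, h⟩
      · exact Or.inr ⟨_, _, hmove _ _ _ h⟩
      · rcases tgt_of_src_petal h with ⟨h, h'⟩ | ⟨_, h'⟩
        · exact Or.inr ⟨_, _, (hv _).trans h'⟩
        · exact Or.inl ((hv _).trans h')
  refine playWon_pairLanguage_iff.2 ⟨i, j, hij, hfreq true, hfreq false, ?_⟩
  refine Filter.eventually_atTop.2 ⟨1, fun k hk c hc => ?_⟩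
  obtain ⟨k, rfl⟩ := Nat.exists_eq_add_of_le' hk
  obtain ⟨b, hb⟩ : ∃ b, G.colour (ρ (k + 1)) = some (sel i j b) := by
    rcases hinv k with h | ⟨b, t, h⟩
    · exact ⟨_, colour_of_tgt ((hv _).symm.trans (hmove _ _ _ h))⟩
    · exact ⟨b, colour_of_src h⟩
  rw [hb] at hc
  cases b <;> simp_all [sel]

/-- If the length of the petals makes all the transformations `f^[N + 2]` of a `k`-element set
idempotent, then for two colours the memory is in the same state after a first petal of either
colour, and comes back to it after each petal of the same colour. So at the hub of these two
colours Eve keeps choosing the same petal. -/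
theorem not_petalGame_eveWinsWithChromaticMemory {k : ℕ} (hk : k < n)
    (hN : ∀ (f : Fin k → Fin k) x, f^[N + 2] (f^[N + 2] x) = f^[N + 2] x) :
    ¬ (petalGame n N hn).EveWinsWithChromaticMemory (pairLanguage (Fin n)) k := by
  rintro ⟨M, ⟨μ, hμ⟩, next, hsrc, -, hwin⟩
  let G := petalGame n N hn
  let f : Fin n → Fin k → Fin k := fun c x => μ x c
  obtain ⟨i, j, hij, hq⟩ := Fintype.exists_ne_map_eq_of_card_lt
    (fun c => (f c)^[N + 2] M.init) (by simpa using hk)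
  set q := (f i)^[N + 2] M.init with hqi
  obtain ⟨b, hb⟩ := tgt_of_src_hub (hsrc (hub i j) ⟨i, j, rfl⟩ q)
  set c := sel i j b
  have hinit : (f c)^[N + 2] M.init = q := by
    cases b
    exacts [hq.symm, rfl]
  have hqq : (f c)^[N + 2] q = q := by rw [← hinit, hN]
  -- Adam opens with the petal that Eve is going to repeat.
  have hadam : ∀ v : PetalVertex n N, ∃ e : G.E, src e = v ∧
      (v = start → tgt e = petal i j b 0) := by
    intro v
    by_cases hv : v = start
    · subst hv
      exact ⟨⟨(_, _), .start hij b⟩, rfl, fun _ => rfl⟩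
    · obtain ⟨e, he⟩ := G.exists_edge v
      exact ⟨e, he, fun h => absurd h hv⟩
  choose adam hadam_src hadam using hadam
  classical
  let move : PetalVertex n N × Fin k → G.E := fun s =>
    if s.1 ∈ G.eve then next s.1 s.2 else adam s.1
  have hmove_src : ∀ s, src (move s) = s.1 := by
    intro s
    simp only [move]
    split_ifs with h
    exacts [hsrc _ h _, hadam_src _]
  let st : ℕ → PetalVertex n N × Fin k := fun t =>
    (fun s => (tgt (move s), M.update s.2 (move s)))^[t] (start, M.init)
  have hst : ∀ t, st (t + 1) = (tgt (move (st t)), M.update (st t).2 (move (st t))) :=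
    fun t => Function.iterate_succ_apply' _ _ _
  let ρ : ℕ → G.E := fun t => move (st t)
  have hρ : G.IsPlay ρ := ⟨hmove_src _, fun t => by simp only [ρ, hmove_src, hst]⟩
  have hmem : ∀ t, (pre ρ t).foldl M.update M.init = (st t).2 := by
    intro t
    induction t with
    | zero => rfl
    | succ t ih => rw [pre_succ, List.foldl_append, ih, hst]; rfl
  have hadh : G.Adheres (M.strategy next) ρ := by
    intro t ht
    have hend : endOf G.init (pre ρ t) = (st t).1 := (endOf_pre hρ t).trans (hmove_src _)
    rw [hend] at ht
    have h1 : M.strategy next (pre ρ t) = next (st t).1 (st t).2 := by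
      rw [← hend, ← hmem]; rfl
    rw [h1]
    exact if_pos ht
  have hupd : ∀ t, G.colour (ρ t) = some c → (st (t + 1)).2 = f c (st t).2 := by
    intro t ht
    rw [hst]
    exact (hμ _ _).1 c ht
  have hinv : ∀ t, G.colour (ρ t) = some c ∧ (st (t + 1) = (hub i j, q) ∨
      ∃ s x, (f c)^[N + 2] x = q ∧ st (t + 1) = (petal i j b s, (f c)^[s.1 + 1] x)) := by
    intro t
    induction t with
    | zero =>
      have h1 : tgt (ρ 0) = petal i j b 0 := by
        have : ¬ (start : PetalVertex n N) ∈ G.eve := by rintro ⟨_, _, h⟩; cases h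
        have h2 : ρ 0 = adam start := if_neg this
        rw [h2]
        exact hadam _ rfl
      have h2 := colour_of_tgt h1
      exact ⟨h2, Or.inr ⟨0, M.init, hinit,
        Prod.ext ((congrArg Prod.fst (hst 0)).trans h1) (hupd 0 h2)⟩⟩
    | succ t ih =>
      rcases ih.2 with h | ⟨s, x, hx, h⟩
      · have h1 : tgt (ρ (t + 1)) = petal i j b 0 := by
          have h2 : ρ (t + 1) = next (hub i j) q := by
            simp only [ρ, h]
            exact if_pos ⟨i, j, rfl⟩
          rw [h2, hb]
        have h2 := colour_of_tgt h1
        refine ⟨h2, Or.inr ⟨0, q, hqq, Prod.ext ((congrArg Prod.fst (hst _)).trans h1) ?_⟩⟩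
        rw [hupd _ h2, h]
        rfl
      · have h0 : src (ρ (t + 1)) = petal i j b s := by
          simp only [ρ, hmove_src, h]
        have h2 := colour_of_src h0
        refine ⟨h2, ?_⟩
        have h3 : (st (t + 1 + 1)).2 = (f c)^[s.1 + 2] x := by
          rw [hupd _ h2, h, Function.iterate_succ_apply' _ (s.1 + 1)]
        rcases tgt_of_src_petal h0 with ⟨hs, h4⟩ | ⟨hs, h4⟩
        · exact Or.inr ⟨_, x, hx, Prod.ext ((congrArg Prod.fst (hst _)).trans h4) h3⟩
        · refine Or.inl (Prod.ext ((congrArg Prod.fst (hst _)).trans h4) ?_)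
          rw [h3, hs, hx]
  obtain ⟨a, d, had, ha, hd, -⟩ := playWon_pairLanguage_iff.1 (hwin ρ hρ hadh)
  obtain ⟨t, ht⟩ := ha.exists
  obtain ⟨t', ht'⟩ := hd.exists
  rw [(hinv t).1] at ht
  rw [(hinv t').1] at ht'
  exact had (Option.some_injective _ (ht.symm.trans ht'))

end PetalGame

/-- With fewer than `n` points, `f^[n !]` is idempotent: it maps each point to a periodic one, and
fixes periodic points. -/
theorem iterate_factorial_idem {k n : ℕ} (hk : k < n) (f : Fin k → Fin k) (x : Fin k) :
    f^[n.factorial] (f^[n.factorial] x) = f^[n.factorial] x := by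
  obtain ⟨a, b, hab, h⟩ := Fintype.exists_ne_map_eq_of_card_lt
    (fun a : Fin (k + 1) => f^[a] x) (by simp)
  wlog hlt : a < b generalizing a b
  · exact this b a hab.symm h.symm (lt_of_le_of_ne (not_lt.1 hlt) hab.symm)
  have hper : Function.IsPeriodicPt f (b.1 - a.1) (f^[a] x) := by
    change f^[b.1 - a.1] (f^[a] x) = f^[a] x
    rw [← Function.iterate_add_apply, Nat.sub_add_cancel hlt.le]
    exact h.symm
  have hdvd : b.1 - a.1 ∣ n.factorial := Nat.dvd_factorial (by omega) (by omega)
  have hle : a.1 ≤ n.factorial := le_trans (by omega) n.self_le_factorial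
  have : f^[n.factorial] x = f^[n.factorial - a.1] (f^[a] x) := by
    rw [← Function.iterate_add_apply, Nat.sub_add_cancel hle]
  rw [this]
  exact (hper.apply_iterate _).trans_dvd hdvd

end ColouredGame

theorem proposition4p5 (n : ℕ) (hn : 2 ≤ n) :
    (∀ (V : Type*) (G : ColouredGame V (Fin n)),
      G.EveWins (ColouredGame.mullerLanguage (ColouredGame.pairCondition n)) →
      G.EveWinsWithMemory (ColouredGame.mullerLanguage (ColouredGame.pairCondition n)) 2) ∧
    (∃ (V : Type) (_ : Finite V) (G : ColouredGame V (Fin n)),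
      G.EpsFree ∧
      G.EveWins (ColouredGame.mullerLanguage (ColouredGame.pairCondition n)) ∧
      G.EveWinsWithMemory (ColouredGame.mullerLanguage (ColouredGame.pairCondition n)) 2 ∧
      IsLeast {k : ℕ | G.EveWinsWithChromaticMemory
        (ColouredGame.mullerLanguage (ColouredGame.pairCondition n)) k} n) := by
  change (∀ (V : Type _) (G : ColouredGame V (Fin n)),
      G.EveWins (ColouredGame.pairLanguage (Fin n)) →
      G.EveWinsWithMemory (ColouredGame.pairLanguage (Fin n)) 2) ∧ _
  have : Nontrivial (Fin n) := Fin.nontrivial_iff_two_le.2 hn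
  refine ⟨fun V G hG => ColouredGame.eveWinsWithMemory_two hG, ?_⟩
  have hfac : n.factorial - 2 + 2 = n.factorial :=
    Nat.sub_add_cancel (hn.trans n.self_le_factorial)
  have hchrom := ColouredGame.petalGame_eveWinsWithChromaticMemory (N := n.factorial - 2) (hn := hn)
  have hwins : (ColouredGame.petalGame n (n.factorial - 2) hn).EveWins
      (ColouredGame.pairLanguage (Fin n)) :=
    let ⟨_, _, _, _, h⟩ := hchrom
    ⟨_, h⟩
  refine ⟨ColouredGame.PetalVertex n (n.factorial - 2), inferInstance,
    ColouredGame.petalGame n (n.factorial - 2) hn, ColouredGame.petalGame_epsFree, hwins,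
    ColouredGame.eveWinsWithMemory_two hwins, hchrom, fun k hk => ?_⟩
  by_contra! hlt
  refine ColouredGame.not_petalGame_eveWinsWithChromaticMemory hlt (fun f x => ?_) hk
  rw [hfac]
  exact ColouredGame.iterate_factorial_idem hlt f x
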